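/- Let $A$ be a finite alphabet, let $A^+$ be the free semigroup of non-empty words over $A$, and let $S$ be a semigroup generated by $A$ through a surjective homomorphism $\pi\colon A^+\to S$. A regular language $R\subseteq A^+$ with $\pi(R)=S$ is a \emph{regular combing} of $S$; it is a regular combing \emph{with uniqueness} if moreover $\pi|_R\colon R\to S$ is a bijection. With two new symbols $\#_1,\#_2$, the \emph{multiplication table} of $S$ with respect to $R$ is $$\mathcal T_S(R)=\{u\,\#_1\,v\,\#_2\,w^{\mathrm{rev}} \mid u,v,w\in R,\ \pi(u)\pi(v)=\pi(w)\},$$ where $w^{\mathrm{rev}}$ is the reverse of $w$. The semigroup $S$ is \emph{word-hyperbolic with uniqueness} (with respect to $R$) if $R$ is a regular combing of $S$ with uniqueness and $\mathcal T_S(R)$ is a context-free language. For disjoint alphabets $A_1,A_2$ and languages $R_i\subseteq A_i^+$, let $\mathrm{Alt}^+(R_1,R_2)$ be the set of non-empty words in $$(R_1R_2)^*\cup(R_2R_1)^*\cup(R_1R_2)^*R_1\cup(R_2R_1)^*R_2 .$$ The semigroup free product $S_1*S_2$ is the semigroup of finite non-empty alternating sequences of elements of the disjoint union $S_1\sqcup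 S_2$ (neighbouring entries come from different factors), with multiplication given by concatenation, followed, if the last entry of the first sequence and the first entry of the second come from the same factor, by replacing these two entries by their product. \textbf{Corollary.} Let $S_1,S_2$ be semigroups that are word-hyperbolic with uniqueness, with respect to regular combings $R_1\subseteq A_1^+$ and $R_2\subseteq A_2^+$ over disjoint finite alphabets $A_1,A_2$. Then the semigroup free product $S_1*S_2$, generated by $A_1\cup A_2$ in the natural way, is word-hyperbolic with uniqueness with respect to the combing $\mathrm{Alt}^+(R_1,R_2)$. In particular, the semigroup free product of two semigroups that are word-hyperbolic with uniqueness is word-hyperbolic with uniqueness. -/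

import Mathlib

open scoped Computability

/-! ### The semigroup free product -/

section FreeProduct

variable {S₁ S₂ : Type*}

/-- Two elements of the disjoint union `S₁ ⊔ S₂` come from different factors. -/
def DiffFactor (x y : S₁ ⊕ S₂) : Prop := x.isLeft ≠ y.isLeft

variable [Semigroup S₁] [Semigroup S₂]

/-- Put `x` in front of a sequence, multiplying it into the first entry of the sequence if that
entry comes from the same factor as `x`. -/
def altCons : S₁ ⊕ S₂ → List (S₁ ⊕ S₂) → List (S₁ ⊕ S₂)
  | .inl a, .inl b :: l => .inl (a * b) :: l
  | .inr a, .inr b :: l => .inr (a * b) :: l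
  | x, l => x :: l

/-- The alternatisation of a sequence: neighbouring entries from the same factor are multiplied
together until the sequence is alternating. -/
def alternatise (l : List (S₁ ⊕ S₂)) : List (S₁ ⊕ S₂) := l.foldr altCons []

theorem altCons_ne_nil (x : S₁ ⊕ S₂) (l : List (S₁ ⊕ S₂)) : altCons x l ≠ [] := by
  rcases x with a | a <;> rcases l with _ | ⟨b | b, l⟩ <;> simp [altCons]

theorem isChain_altCons (x : S₁ ⊕ S₂) {l : List (S₁ ⊕ S₂)} (h : l.IsChain DiffFactor) :
    (altCons x l).IsChain DiffFactor := by
  rcases x with a | a <;> rcases l with _ | ⟨b | b, _ | ⟨c | c, l⟩⟩ <;>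
    simp_all [altCons, DiffFactor]

theorem altCons_of_isChain {x : S₁ ⊕ S₂} {l : List (S₁ ⊕ S₂)}
    (h : (x :: l).IsChain DiffFactor) : altCons x l = x :: l := by
  rcases x with a | a <;> rcases l with _ | ⟨b | b, l⟩ <;> simp_all [altCons, DiffFactor]

theorem isChain_alternatise (l : List (S₁ ⊕ S₂)) : (alternatise l).IsChain DiffFactor := by
  induction l with
  | nil => simp [alternatise]
  | cons x l ih => exact isChain_altCons x ih

theorem alternatise_ne_nil {l : List (S₁ ⊕ S₂)} (h : l ≠ []) : alternatise l ≠ [] := by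
  cases l with
  | nil => exact absurd rfl h
  | cons x l => exact altCons_ne_nil x _

/-- An alternating sequence is its own alternatisation. -/
theorem alternatise_of_isChain {l : List (S₁ ⊕ S₂)} (h : l.IsChain DiffFactor) :
    alternatise l = l := by
  induction l with
  | nil => rfl
  | cons x l ih =>
    have h' : l.IsChain DiffFactor := h.tail
    change altCons x (alternatise l) = x :: l
    rw [ih h', altCons_of_isChain h]

theorem alternatise_append (l m : List (S₁ ⊕ S₂)) :
    alternatise (l ++ m) = l.foldr altCons (alternatise m) := by
  simp [alternatise, List.foldr_append]

theorem foldr_altCons_altCons (x : S₁ ⊕ S₂) (l m : List (S₁ ⊕ S₂)) :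
    (altCons x l).foldr altCons m = altCons x (l.foldr altCons m) := by
  rcases x with a | a <;> rcases l with _ | ⟨b | b, l⟩ <;> simp only [altCons, List.foldr] <;>
    rcases l.foldr altCons m with _ | ⟨c | c, k⟩ <;> simp [mul_assoc]

theorem foldr_alternatise (l m : List (S₁ ⊕ S₂)) :
    (alternatise l).foldr altCons m = l.foldr altCons m := by
  induction l with
  | nil => rfl
  | cons x l ih =>
    change (altCons x (alternatise l)).foldr altCons m = altCons x (l.foldr altCons m)
    rw [foldr_altCons_altCons, ih]

variable (S₁ S₂) in
/-- The semigroup free product of `S₁` and `S₂`: its elements are the finite non-empty alternating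
sequences of elements of `S₁ ⊔ S₂`. -/
@[ext]
structure SgpFreeProduct where
  seq : List (S₁ ⊕ S₂)
  ne_nil : seq ≠ []
  alternating : seq.IsChain DiffFactor

namespace SgpFreeProduct

/-- The product of two alternating sequences is the alternatisation of their concatenation. -/
instance : Mul (SgpFreeProduct S₁ S₂) where
  mul s t := ⟨alternatise (s.seq ++ t.seq), alternatise_ne_nil (by simp [s.ne_nil]),
    isChain_alternatise _⟩

theorem seq_mul (s t : SgpFreeProduct S₁ S₂) : (s * t).seq = alternatise (s.seq ++ t.seq) := rfl

theorem seq_mul_eq_foldr (s t : SgpFreeProduct S₁ S₂) :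
    (s * t).seq = s.seq.foldr altCons t.seq := by
  rw [seq_mul, alternatise_append, alternatise_of_isChain t.alternating]

instance : Semigroup (SgpFreeProduct S₁ S₂) where
  mul_assoc s t u := by
    ext1
    rw [seq_mul_eq_foldr, seq_mul, foldr_alternatise, List.foldr_append, seq_mul_eq_foldr,
      seq_mul_eq_foldr]

/-- The one-term sequence given by an element of one of the factors. -/
def of (x : S₁ ⊕ S₂) : SgpFreeProduct S₁ S₂ := ⟨[x], by simp, by simp⟩

/-- For `πᵢ : Aᵢ⁺ → Sᵢ`, the homomorphism `(A₁ ⊔ A₂)⁺ → S₁ ∗ S₂` that agrees with `πᵢ` on the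
letters of `Aᵢ`. -/
def wordHom {A₁ A₂ : Type*} (π₁ : FreeSemigroup A₁ →ₙ* S₁) (π₂ : FreeSemigroup A₂ →ₙ* S₂) :
    FreeSemigroup (A₁ ⊕ A₂) →ₙ* SgpFreeProduct S₁ S₂ :=
  FreeSemigroup.lift fun x =>
    of (Sum.map (fun a => π₁ (FreeSemigroup.of a)) (fun b => π₂ (FreeSemigroup.of b)) x)

end SgpFreeProduct

end FreeProduct

/-! ### Word-hyperbolic semigroups -/

/-- An element of the free semigroup `A⁺`, as a non-empty word over `A`. -/
def FreeSemigroup.toWord {A : Type*} (u : FreeSemigroup A) : List A := u.head :: u.tail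

/-- The two separating symbols `#₁` and `#₂`. -/
inductive Separator
  | one
  | two

section WordHyperbolic

variable {A S : Type*} [Semigroup S]

/-- `R ⊆ A⁺` is a regular combing of `S`, where `S` is generated by `A` through the surjective
homomorphism `π : A⁺ → S`: it is a regular language in which every element of `S` has a
representative. -/
structure IsRegularCombing (π : FreeSemigroup A →ₙ* S) (R : Set (FreeSemigroup A)) : Prop where
  surjective : Function.Surjective π
  regular : Language.IsRegular (FreeSemigroup.toWord '' R : Language A)
  surjOn : Set.SurjOn π R Set.univ

/-- The word `u #₁ v #₂ w^rev` over the alphabet `A ∪ {#₁, #₂}`. -/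
def tableWord (u v w : FreeSemigroup A) : List (A ⊕ Separator) :=
  u.toWord.map .inl ++ [.inr .one] ++ v.toWord.map .inl ++ [.inr .two] ++
    (w.toWord.map .inl).reverse

/-- The multiplication table of `S` with respect to `R`: all words `u #₁ v #₂ w^rev` where
`u, v, w ∈ R` and `u v = w` in `S`. -/
def multTable (π : FreeSemigroup A →ₙ* S) (R : Set (FreeSemigroup A)) :
    Language (A ⊕ Separator) :=
  {z | ∃ u ∈ R, ∃ v ∈ R, ∃ w ∈ R, π u * π v = π w ∧ z = tableWord u v w}

/-- `S` is word-hyperbolic with uniqueness with respect to the combing `R ⊆ A⁺`: `R` is a regular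
combing, every element of `S` has exactly one representative in `R`, and the multiplication table
is context-free. -/
structure IsWordHyperbolicWithUniquenessWrt (π : FreeSemigroup A →ₙ* S)
    (R : Set (FreeSemigroup A)) : Prop where
  combing : IsRegularCombing π R
  bijOn : Set.BijOn π R Set.univ
  contextFree : (multTable π R).IsContextFree

variable (S) in
/-- `S` is word-hyperbolic with uniqueness: it is so with respect to some combing over some finite
generating alphabet. -/
def IsWordHyperbolicWithUniqueness : Prop :=
  ∃ (A : Type) (_ : Finite A) (π : FreeSemigroup A →ₙ* S) (R : Set (FreeSemigroup A)),
    IsWordHyperbolicWithUniquenessWrt π R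

end WordHyperbolic

/-! ### Alternating words -/

/-- The language `Alt(L₁, L₂)` of `(L₁, L₂)`-alternating words. -/
def altLanguage {B : Type*} (L₁ L₂ : Language B) : Language B :=
  (L₁ * L₂)∗ + (L₂ * L₁)∗ + (L₁ * L₂)∗ * L₁ + (L₂ * L₁)∗ * L₂

/-- The set `Alt⁺(R₁, R₂) ⊆ (A₁ ⊔ A₂)⁺` of non-empty `(R₁, R₂)`-alternating words, where
`Rᵢ ⊆ Aᵢ⁺` is regarded as a set of words over the disjoint union of the alphabets. -/
def altPlus {A₁ A₂ : Type*} (R₁ : Set (FreeSemigroup A₁)) (R₂ : Set (FreeSemigroup A₂)) :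
    Set (FreeSemigroup (A₁ ⊕ A₂)) :=
  {u | u.toWord ∈ altLanguage
    (Language.map Sum.inl (FreeSemigroup.toWord '' R₁ : Language A₁))
    (Language.map Sum.inr (FreeSemigroup.toWord '' R₂ : Language A₂))}

/-! A word of `altPlus R₁ R₂` is the spelling of an alternating sequence of blocks from `R₁` and
`R₂`. Mapping it to the free product evaluates each block in its own factor, since nothing merges in
an alternating sequence (`seq_wordHom`). Bijectivity on `R₁` and `R₂` therefore passes entrywise to
`altPlus R₁ R₂`. An automaton that runs automata for `R₁` and `R₂` in turn gives regularity, also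
with conditions on the factors of the two end blocks (`isRegular_sidedLanguage`).

For the table, only the junction of the two sequences matters. If the factors there differ, the
product is represented by the concatenation, giving words `p #₁ q #₂ (p q)^rev`. If they agree, the
two blocks `u`, `v` there are replaced by the representative `w` of their product. This has the same
factor, so no further merging occurs, and the words are `p u #₁ v q #₂ q^rev w^rev p^rev`. By
uniqueness the untouched parts `p` and `q` recur letter for letter in the result, which is what a
pushdown can check. Hence the table is a union of four languages (`multTable_altPlus`). Each of them
is built from single letters or the table of a factor by substitution, product and mirrored wrapping
in regular languages, all of which preserve context-freeness (`IsContextFree.subst`,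
`IsContextFree.mul`, `IsContextFree.sandwich`). -/

/-! ### Context-free languages -/

namespace ContextFreeGrammar

variable {T T' : Type*}

/-- The language of a symbol, given the languages of the nonterminals. -/
def symbolLanguage {N : Type*} (I : N → Language T) : Symbol T N → Language T
  | .terminal a => {[a]}
  | .nonterminal n => I n

/-- The words generated by a nonterminal. -/
def languageFrom (g : ContextFreeGrammar T) (n : g.NT) : Language T :=
  {w | g.Derives [.nonterminal n] (w.map .terminal)}

/-- Symbols are rewritten independently of their neighbours, so the derivations of the factors of
`w` can be run one after another. -/
theorem derives_of_mem_prod (g : ContextFreeGrammar T) {s : List (Symbol T g.NT)} {w : List T}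
    (h : w ∈ (s.map (symbolLanguage g.languageFrom)).prod) : g.Derives s (w.map .terminal) := by
  induction s generalizing w with
  | nil =>
    obtain rfl : w = [] := h
    exact .refl _
  | cons x s ih =>
    rw [List.map_cons, List.prod_cons] at h
    obtain ⟨u, hu, v, hv, rfl⟩ := Language.mem_mul.1 h
    rw [List.map_append]
    have h₁ : g.Derives [x] (u.map .terminal) := by
      cases x with
      | terminal a =>
        obtain rfl : u = [a] := hu
        exact .refl _
      | nonterminal n => exact hu
    exact (h₁.append_right s).trans ((ih hv).append_left _)

theorem prod_symbolLanguage_terminal {N : Type*} (I : N → Language T) (w : List T) :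
    ((w.map Symbol.terminal).map (symbolLanguage I)).prod = {w} := by
  induction w with
  | nil => rfl
  | cons a w ih =>
    rw [List.map_cons, List.map_cons, List.prod_cons, ih]
    ext x
    simp only [Language.mem_mul, symbolLanguage]
    constructor
    · rintro ⟨_, rfl, _, rfl, rfl⟩
      rfl
    · rintro rfl
      exact ⟨_, rfl, _, rfl, rfl⟩

/-- If the languages `I n` are closed under the rules of the grammar, then they contain whatever
the grammar generates. -/
theorem mem_prod_of_derives (g : ContextFreeGrammar T) {I : g.NT → Language T}
    (hI : ∀ r ∈ g.rules, (r.output.map (symbolLanguage I)).prod ≤ I r.input)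
    {s : List (Symbol T g.NT)} {w : List T} (h : g.Derives s (w.map .terminal)) :
    w ∈ (s.map (symbolLanguage I)).prod := by
  -- The induction peels off the first step: undoing a rule replaces its output by its input inside
  -- the product, which only enlarges the product by `hI`.
  induction h using Relation.ReflTransGen.head_induction_on with
  | refl =>
    rw [prod_symbolLanguage_terminal]
    rfl
  | head h _ ih =>
    obtain ⟨r, hr, hrw⟩ := h
    obtain ⟨p, q, rfl, rfl⟩ := hrw.exists_parts
    simp only [List.map_append, List.prod_append, List.map_cons, List.map_nil,
      List.prod_cons, List.prod_nil, mul_one] at ih ⊢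
    exact mul_le_mul' (mul_le_mul' le_rfl (hI r hr)) le_rfl ih

/-- This bounds a grammar's language from above: guess a language for every nonterminal and check
the rules one at a time. Together with `prod_le_languageFrom` it characterises `languageFrom` as the
least family closed under the rules. -/
theorem mem_of_mem_languageFrom (g : ContextFreeGrammar T) {I : g.NT → Language T}
    (hI : ∀ r ∈ g.rules, (r.output.map (symbolLanguage I)).prod ≤ I r.input)
    {n : g.NT} {w : List T} (h : w ∈ g.languageFrom n) : w ∈ I n := by
  simpa [symbolLanguage] using g.mem_prod_of_derives hI h

theorem prod_le_languageFrom (g : ContextFreeGrammar T) {r : ContextFreeRule T g.NT}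
    (hr : r ∈ g.rules) :
    (r.output.map (symbolLanguage g.languageFrom)).prod ≤ g.languageFrom r.input := by
  intro w hw
  have : g.Produces [.nonterminal r.input] r.output := ⟨r, hr, .input_output⟩
  exact this.trans_derives (g.derives_of_mem_prod hw)

/-- A map of symbols that turns rules into steps turns derivations into derivations. -/
theorem Derives.map {g : ContextFreeGrammar T} {g' : ContextFreeGrammar T'}
    (φ : Symbol T g.NT → Symbol T' g'.NT)
    (hφ : ∀ r ∈ g.rules, g'.Produces [φ (.nonterminal r.input)] (r.output.map φ))
    {s t : List (Symbol T g.NT)} (h : g.Derives s t) : g'.Derives (s.map φ) (t.map φ) := by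
  induction h with
  | refl => exact .refl _
  | tail _ h ih =>
    obtain ⟨r, hr, hrw⟩ := h
    obtain ⟨p, q, rfl, rfl⟩ := hrw.exists_parts
    refine ih.trans_produces ?_
    simpa using ((hφ r hr).append_left (p.map φ)).append_right (q.map φ)

end ContextFreeGrammar

/-! ### Closure of context-free languages under substitution and mirrored wrapping -/

namespace Language

open ContextFreeGrammar

variable {α β : Type*}

/-- The language obtained from `L` by replacing each letter `a` by a word of `f a`. -/
def subst (L : Language α) (f : α → Language β) : Language β :=
  {w | ∃ x ∈ L, w ∈ (x.map f).prod}

theorem mem_subst {L : Language α} {f : α → Language β} {w : List β} :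
    w ∈ L.subst f ↔ ∃ x ∈ L, w ∈ (x.map f).prod := Iff.rfl

theorem subst_mul (L M : Language α) (f : α → Language β) :
    (L * M).subst f = L.subst f * M.subst f := by
  ext w
  simp only [mem_subst, mem_mul]
  constructor
  · rintro ⟨_, ⟨x, hx, y, hy, rfl⟩, hw⟩
    rw [List.map_append, List.prod_append] at hw
    obtain ⟨u, hu, v, hv, rfl⟩ := mem_mul.1 hw
    exact ⟨u, ⟨x, hx, hu⟩, v, ⟨y, hy, hv⟩, rfl⟩
  · rintro ⟨u, ⟨x, hx, hu⟩, v, ⟨y, hy, hv⟩, rfl⟩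
    refine ⟨_, ⟨x, hx, y, hy, rfl⟩, ?_⟩
    rw [List.map_append, List.prod_append]
    exact append_mem_mul hu hv

theorem subst_singleton (x : List α) (f : α → Language β) :
    ({x} : Language α).subst f = (x.map f).prod := by
  ext w
  constructor
  · rintro ⟨_, rfl, hw⟩
    exact hw
  · exact fun hw => ⟨x, rfl, hw⟩

theorem subst_prod (l : List (Language α)) (f : α → Language β) :
    l.prod.subst f = (l.map (subst · f)).prod := by
  induction l with
  | nil => exact subst_singleton [] f
  | cons L l ih => rw [List.prod_cons, subst_mul, ih, List.map_cons, List.prod_cons]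

theorem subst_mono {L M : Language α} (h : L ≤ M) (f : α → Language β) :
    L.subst f ≤ M.subst f := fun _ ⟨x, hx, hw⟩ => ⟨x, h hx, hw⟩

section SubstGrammar

variable {n : ℕ} (g : ContextFreeGrammar α) (e : α ≃ Fin n) (G : Fin n → ContextFreeGrammar β)

/-- The symbols of `g` as nonterminals of the grammar for a substitution. -/
def substOuter : Symbol α g.NT → Symbol β (g.NT ⊕ Σ i, (G i).NT)
  | .terminal a => .nonterminal (.inr ⟨e a, (G (e a)).initial⟩)
  | .nonterminal m => .nonterminal (.inl m)

/-- The symbols of `G i` as symbols of the grammar for a substitution. -/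
def substInner (i : Fin n) : Symbol β (G i).NT → Symbol β (g.NT ⊕ Σ i, (G i).NT)
  | .terminal b => .terminal b
  | .nonterminal m => .nonterminal (.inr ⟨i, m⟩)

/-- The rules of the grammar for a substitution. -/
def substRules : Set (ContextFreeRule β (g.NT ⊕ Σ i, (G i).NT)) :=
  (fun r : ContextFreeRule α g.NT => ⟨.inl r.input, r.output.map (substOuter g e G)⟩) '' g.rules ∪
    ⋃ i, (fun r : ContextFreeRule β (G i).NT =>
      ⟨.inr ⟨i, r.input⟩, r.output.map (substInner g G i)⟩) '' (G i).rules

theorem finite_substRules : (substRules g e G).Finite :=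
  (g.rules.finite_toSet.image _).union
    (Set.finite_iUnion fun i => (G i).rules.finite_toSet.image _)

/-- The grammar that generates from `g` and then expands each terminal `a` by `G (e a)`. -/
noncomputable abbrev substGrammar : ContextFreeGrammar β where
  NT := g.NT ⊕ Σ i, (G i).NT
  initial := .inl g.initial
  rules := (finite_substRules g e G).toFinset

theorem derives_substInner (i : Fin n) {s t : List (Symbol β (G i).NT)} (h : (G i).Derives s t) :
    (substGrammar g e G).Derives (s.map (substInner g G i)) (t.map (substInner g G i)) := by
  refine h.map (g' := substGrammar g e G) _ fun r hr => ?_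
  refine ⟨⟨.inr ⟨i, r.input⟩, r.output.map (substInner g G i)⟩, ?_, .input_output⟩
  exact (Set.Finite.mem_toFinset _).2 (.inr (Set.mem_iUnion.2 ⟨i, r, hr, rfl⟩))

theorem derives_substOuter {s t : List (Symbol α g.NT)} (h : g.Derives s t) :
    (substGrammar g e G).Derives (s.map (substOuter g e G)) (t.map (substOuter g e G)) := by
  refine h.map (g' := substGrammar g e G) _ fun r hr => ?_
  refine ⟨⟨.inl r.input, r.output.map (substOuter g e G)⟩, ?_, .input_output⟩
  exact (Set.Finite.mem_toFinset _).2 (.inl ⟨r, hr, rfl⟩)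

theorem languageFrom_le_languageFrom_substInner (i : Fin n) (m : (G i).NT) :
    (G i).languageFrom m ≤ (substGrammar g e G).languageFrom (.inr ⟨i, m⟩) := by
  intro w hw
  have := derives_substInner g e G i hw
  rw [List.map_map] at this
  exact this

/-- For the upper bound, a nonterminal of `g` is assigned the substituted image of its language and
a nonterminal of `G i` its own language; the rules respect this because substitution commutes with
products. For the lower bound, derive in `g` first and then expand every letter. -/
theorem language_substGrammar :
    (substGrammar g e G).language = g.language.subst fun a => (G (e a)).language := by
  set f : α → Language β := fun a => (G (e a)).language
  ext w
  constructor
  · let I : (g.NT ⊕ Σ i, (G i).NT) → Language β :=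
      Sum.elim (fun m => (g.languageFrom m).subst f) fun p => (G p.1).languageFrom p.2
    refine mem_of_mem_languageFrom (substGrammar g e G) (I := I) fun r hr => ?_
    obtain ⟨r, hr', rfl⟩ | hr' := (Set.Finite.mem_toFinset _).1 hr
    · have key : ∀ x, symbolLanguage I (substOuter g e G x) =
          (symbolLanguage g.languageFrom x).subst f := by
        rintro (a | m)
        · exact ((subst_singleton [a] f).trans (by simp; rfl)).symm
        · rfl
      calc ((r.output.map (substOuter g e G)).map (symbolLanguage I)).prod
          = (r.output.map (symbolLanguage g.languageFrom)).prod.subst f := by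
            rw [subst_prod, List.map_map, List.map_map]
            exact congrArg List.prod (List.map_congr_left fun x _ => key x)
        _ ≤ _ := subst_mono (g.prod_le_languageFrom hr') f
    · obtain ⟨i, r, hr'', rfl⟩ := Set.mem_iUnion.1 hr'
      have key : ∀ x, symbolLanguage I (substInner g G i x) =
          symbolLanguage (G i).languageFrom x := by
        rintro (a | m) <;> rfl
      calc ((r.output.map (substInner g G i)).map (symbolLanguage I)).prod
          = (r.output.map (symbolLanguage (G i).languageFrom)).prod := by
            rw [List.map_map]
            exact congrArg List.prod (List.map_congr_left fun x _ => key x)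
        _ ≤ _ := (G i).prod_le_languageFrom hr''
  · rintro ⟨x, hx, hw⟩
    refine (derives_substOuter g e G hx).trans (derives_of_mem_prod _ ?_)
    suffices h : (x.map f).prod ≤ (((x.map Symbol.terminal).map (substOuter g e G)).map
        (symbolLanguage (substGrammar g e G).languageFrom)).prod from h hw
    rw [List.map_map, List.map_map]
    clear hx hw
    induction x with
    | nil => exact le_rfl
    | cons a x ih =>
      simp only [List.map_cons, List.prod_cons]
      exact mul_le_mul' (languageFrom_le_languageFrom_substInner g e G _ _) ih

end SubstGrammar

/-- Context-free languages over a finite alphabet are closed under context-free substitution. -/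
theorem IsContextFree.subst [Finite α] {L : Language α} (hL : L.IsContextFree)
    {f : α → Language β} (hf : ∀ a, (f a).IsContextFree) : (L.subst f).IsContextFree := by
  obtain ⟨g, rfl⟩ := hL
  choose F hF using hf
  -- Indexing by `Fin n` keeps the nonterminals of the combined grammar in the universe of the given
  -- ones, whatever the universe of `α`.
  obtain ⟨n, ⟨e⟩⟩ := Finite.exists_equiv_fin α
  refine ⟨substGrammar g e fun i => F (e.symm i), ?_⟩
  rw [language_substGrammar]
  simp only [Equiv.symm_apply_apply, hF]

theorem isContextFree_of_finite {L : Language α} (hL : Set.Finite (L : Set (List α))) :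
    L.IsContextFree := by
  let g : ContextFreeGrammar α :=
    { NT := Unit
      initial := ()
      rules := (hL.image fun w => ⟨(), w.map Symbol.terminal⟩).toFinset }
  refine ⟨g, ?_⟩
  ext w
  constructor
  · refine mem_of_mem_languageFrom g (I := fun _ => L) fun r hr => ?_
    obtain ⟨u, hu, rfl⟩ := (Set.Finite.mem_toFinset _).1 hr
    intro v hv
    rw [prod_symbolLanguage_terminal] at hv
    obtain rfl : v = u := hv
    exact hu
  · intro hw
    refine Produces.single ⟨⟨(), w.map Symbol.terminal⟩, ?_, .input_output⟩
    exact (Set.Finite.mem_toFinset _).2 ⟨w, hw, rfl⟩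

theorem isContextFree_singleton (w : List α) : ({w} : Language α).IsContextFree :=
  isContextFree_of_finite (Set.finite_singleton w)

/-- A product is a substitution into the single word `[true, false]`; likewise a union is a
substitution into the two words `[true]` and `[false]`. -/
theorem IsContextFree.mul {L M : Language α} (hL : L.IsContextFree) (hM : M.IsContextFree) :
    (L * M).IsContextFree := by
  have := (isContextFree_singleton [true, false]).subst (f := fun b => bif b then L else M)
    (by simp [hL, hM])
  simpa [subst_singleton] using this

theorem IsContextFree.add {L M : Language α} (hL : L.IsContextFree) (hM : M.IsContextFree) :
    (L + M).IsContextFree := by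
  have := (isContextFree_of_finite (L := ({[true], [false]} : Set (List Bool)))
    (Set.toFinite _)).subst (f := fun b => bif b then L else M) (by simp [hL, hM])
  convert! this using 1
  ext w
  constructor
  · rintro (h | h)
    · exact ⟨[true], .inl rfl, by simpa using (show w ∈ L from h)⟩
    · exact ⟨[false], .inr rfl, by simpa using (show w ∈ M from h)⟩
  · rintro ⟨_, rfl | rfl, h⟩
    · exact .inl (show w ∈ L by simpa using h)
    · exact .inr (show w ∈ M by simpa using h)

theorem prod_map_singleton (x : List α) (f : α → β) :
    (x.map fun a => ({[f a]} : Language β)).prod = {x.map f} := by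
  have := prod_symbolLanguage_terminal (N := Unit) (fun _ => 0) (x.map f)
  rwa [List.map_map, List.map_map] at this

theorem singleton_mul_singleton (x y : List α) : ({x} * {y} : Language α) = {x ++ y} :=
  Set.image2_singleton

/-- The words `p ∙ p^rev` with `p` in a regular language. -/
theorem IsRegular.isContextFree_mirror [Finite α] {L : Language α} (hL : L.IsRegular) :
    IsContextFree ({w | ∃ p ∈ L, w = p.map some ++ none :: (p.map some).reverse} :
      Set (List (Option α))) := by
  obtain ⟨σ, _, M, rfl⟩ := hL
  -- The nonterminals are the states of the automaton. A state emits the letter it reads on both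
  -- sides at once, and the centre mark `none` only if it is accepting.
  let R : Set (ContextFreeRule (Option α) σ) :=
    Set.range (fun x : σ × α => ⟨x.1, [.terminal (some x.2), .nonterminal (M.step x.1 x.2),
      .terminal (some x.2)]⟩) ∪ (fun q => ⟨q, [.terminal none]⟩) '' M.accept
  have hR : R.Finite := (Set.finite_range _).union (Set.Finite.image _ (Set.toFinite _))
  let g : ContextFreeGrammar (Option α) := { NT := σ, initial := M.start, rules := hR.toFinset }
  refine ⟨g, ?_⟩
  ext w
  constructor
  · let I : σ → Language (Option α) := fun q => {w | ∃ p ∈ M.acceptsFrom q,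
      w = p.map some ++ none :: (p.map some).reverse}
    refine mem_of_mem_languageFrom g (n := M.start) (I := I) fun r hr => ?_
    obtain ⟨⟨q, a⟩, rfl⟩ | ⟨q, hq, rfl⟩ := hR.mem_toFinset.1 hr
    · intro v hv
      have e : ([.terminal (some a), .nonterminal (M.step q a), .terminal (some a)].map
          (symbolLanguage I)).prod = {[some a]} * (I (M.step q a) * {[some a]}) := by
        simp [symbolLanguage]
      rw [e] at hv
      obtain ⟨_, rfl, _, ⟨_, ⟨p, hp, rfl⟩, _, rfl, rfl⟩, rfl⟩ := hv
      exact ⟨a :: p, hp, by simp⟩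
    · intro v hv
      simp only [List.map_cons, List.map_nil, List.prod_cons, List.prod_nil, mul_one,
        symbolLanguage] at hv
      exact ⟨[], hq, hv⟩
  · rintro ⟨p, hp, rfl⟩
    suffices h : ∀ q, p ∈ M.acceptsFrom q → p.map some ++ none :: (p.map some).reverse ∈
      g.languageFrom q from h _ hp
    clear hp
    induction p with
    | nil =>
      intro q hq
      exact g.prod_le_languageFrom (r := ⟨q, [.terminal none]⟩)
        (hR.mem_toFinset.2 (.inr ⟨q, hq, rfl⟩)) (by simp [symbolLanguage]; rfl)
    | cons a p ih =>
      intro q hq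
      refine g.prod_le_languageFrom (r := ⟨q, [.terminal (some a), .nonterminal (M.step q a),
        .terminal (some a)]⟩) (hR.mem_toFinset.2 (.inl ⟨(q, a), rfl⟩)) ?_
      simp only [List.map_cons, List.map_nil, List.prod_cons, List.prod_nil, mul_one,
        symbolLanguage]
      exact ⟨_, rfl, _, ⟨_, ih _ hq, _, rfl, rfl⟩, by simp⟩

/-- The words `p d p^rev` with `p ∈ L` (regarded as a word over another alphabet) and `d ∈ D`. -/
def sandwich (L : Language α) (f : α → β) (D : Language β) : Language β :=
  {w | ∃ p ∈ L, ∃ d ∈ D, w = p.map f ++ d ++ (p.map f).reverse}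

/-- Substitute `D` for the centre mark of the mirrored words, and the letter `f a` for each `some
a`. -/
theorem IsContextFree.sandwich [Finite α] {L : Language α} (hL : L.IsRegular) (f : α → β)
    {D : Language β} (hD : D.IsContextFree) : (L.sandwich f D).IsContextFree := by
  have := hL.isContextFree_mirror.subst (f := fun o => o.elim D fun a => {[f a]})
    (by rintro (_ | a); exacts [hD, isContextFree_singleton _])
  convert! this using 1
  have key : ∀ p : List α, ((p.map some ++ none :: (p.map some).reverse).map
      fun o : Option α => o.elim D fun a => {[f a]}).prod =
        {p.map f} * (D * {(p.map f).reverse}) := by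
    intro p
    rw [List.map_append, List.prod_append, List.map_cons, List.prod_cons, List.map_map,
      ← List.map_reverse, List.map_map, ← List.map_reverse]
    exact congrArg₂ _ (prod_map_singleton p f) (congrArg _ (prod_map_singleton p.reverse f))
  ext w
  constructor
  · rintro ⟨p, hp, d, hd, rfl⟩
    refine ⟨_, ⟨p, hp, rfl⟩, ?_⟩
    rw [key]
    exact ⟨_, rfl, _, ⟨_, hd, _, rfl, rfl⟩, by simp⟩
  · rintro ⟨_, ⟨p, hp, rfl⟩, hw⟩
    rw [key] at hw
    obtain ⟨_, rfl, _, ⟨d, hd, _, rfl, rfl⟩, rfl⟩ := hw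
    exact ⟨p, hp, d, hd, by simp⟩

end Language

/-! ### Alternating words as sequences of blocks -/

section Blocks

variable {A : Type*}

theorem FreeSemigroup.toWord_injective :
    Function.Injective (FreeSemigroup.toWord : FreeSemigroup A → List A) := by
  rintro ⟨a, u⟩ ⟨b, v⟩ h
  simpa [FreeSemigroup.toWord] using h

theorem FreeSemigroup.exists_toWord_eq {w : List A} (hw : w ≠ []) :
    ∃ u : FreeSemigroup A, u.toWord = w := by
  obtain ⟨a, u, rfl⟩ := List.exists_cons_of_ne_nil hw
  exact ⟨⟨a, u⟩, rfl⟩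

theorem FreeSemigroup.toWord_ne_nil (u : FreeSemigroup A) : u.toWord ≠ [] :=
  List.cons_ne_nil _ _

theorem FreeSemigroup.toWord_mul (u v : FreeSemigroup A) :
    (u * v).toWord = u.toWord ++ v.toWord := rfl

variable {A₁ A₂ : Type*}

/-- The word spelled by a block. -/
def blockWord : FreeSemigroup A₁ ⊕ FreeSemigroup A₂ → List (A₁ ⊕ A₂)
  | .inl u => u.toWord.map .inl
  | .inr v => v.toWord.map .inr

/-- The word spelled by a sequence of blocks. -/
def blocksWord (l : List (FreeSemigroup A₁ ⊕ FreeSemigroup A₂)) : List (A₁ ⊕ A₂) :=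
  l.flatMap blockWord

@[simp]
theorem blocksWord_nil : blocksWord ([] : List (FreeSemigroup A₁ ⊕ FreeSemigroup A₂)) = [] := rfl

@[simp]
theorem blocksWord_cons (x : FreeSemigroup A₁ ⊕ FreeSemigroup A₂)
    (l : List (FreeSemigroup A₁ ⊕ FreeSemigroup A₂)) :
    blocksWord (x :: l) = blockWord x ++ blocksWord l := rfl

@[simp]
theorem blocksWord_append (l m : List (FreeSemigroup A₁ ⊕ FreeSemigroup A₂)) :
    blocksWord (l ++ m) = blocksWord l ++ blocksWord m := List.flatMap_append

/-- The factor of the first entry of a sequence. -/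
def headSide {X Y : Type*} (l : List (X ⊕ Y)) : Option Bool := l.head?.map Sum.isLeft

/-- The factor of the last entry of a sequence. -/
def lastSide {X Y : Type*} (l : List (X ⊕ Y)) : Option Bool := l.getLast?.map Sum.isLeft

theorem headSide_blocksWord (l : List (FreeSemigroup A₁ ⊕ FreeSemigroup A₂)) :
    headSide (blocksWord l) = headSide l := by
  rcases l with _ | ⟨u | v, l⟩ <;> simp [headSide, blockWord, FreeSemigroup.toWord]

theorem lastSide_blocksWord (l : List (FreeSemigroup A₁ ⊕ FreeSemigroup A₂)) :
    lastSide (blocksWord l) = lastSide l := by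
  have key : ∀ x : FreeSemigroup A₁ ⊕ FreeSemigroup A₂, ∃ y ∈ (blockWord x).getLast?,
      y.isLeft = x.isLeft := by
    rintro (u | v)
    · exact ⟨_, by simp [blockWord, List.getLast?_eq_getLast_of_ne_nil u.toWord_ne_nil]; rfl, rfl⟩
    · exact ⟨_, by simp [blockWord, List.getLast?_eq_getLast_of_ne_nil v.toWord_ne_nil]; rfl, rfl⟩
  rcases List.eq_nil_or_concat l with rfl | ⟨l, x, rfl⟩
  · rfl
  · obtain ⟨y, hy, hxy⟩ := key x
    rw [Option.mem_def] at hy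
    simp [lastSide, List.getLast?_append, hy, hxy]

theorem blocksWord_eq_nil {l : List (FreeSemigroup A₁ ⊕ FreeSemigroup A₂)} :
    blocksWord l = [] ↔ l = [] := by
  rcases l with _ | ⟨u | v, l⟩ <;> simp [blockWord, FreeSemigroup.toWord]

variable (R₁ : Set (FreeSemigroup A₁)) (R₂ : Set (FreeSemigroup A₂))

/-- The alternating sequences of words of `R₁` and of `R₂`. -/
structure IsBlockSeq (l : List (FreeSemigroup A₁ ⊕ FreeSemigroup A₂)) : Prop where
  chain : l.IsChain DiffFactor
  left : ∀ u, .inl u ∈ l → u ∈ R₁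
  right : ∀ v, .inr v ∈ l → v ∈ R₂

theorem isBlockSeq_nil : IsBlockSeq R₁ R₂ [] := ⟨by simp, by simp, by simp⟩

variable {R₁ R₂}

/-- Alternation only concerns neighbours, so concatenation adds a single test at the junction. The
side is `true` for the first factor, and `none` for an empty sequence, which passes the test. -/
theorem isBlockSeq_append {l m : List (FreeSemigroup A₁ ⊕ FreeSemigroup A₂)} :
    IsBlockSeq R₁ R₂ (l ++ m) ↔ IsBlockSeq R₁ R₂ l ∧ IsBlockSeq R₁ R₂ m ∧
      ∀ b, lastSide l = some b → headSide m ≠ some b := by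
  have key : (∀ x ∈ l.getLast?, ∀ y ∈ m.head?, DiffFactor x y) ↔
      ∀ b, lastSide l = some b → headSide m ≠ some b := by
    rcases h : l.getLast? with _ | x <;> rcases h' : m.head? with _ | y <;>
      simp [lastSide, headSide, h, h', DiffFactor, eq_comm]
  constructor
  · rintro ⟨h, h₁, h₂⟩
    obtain ⟨hl, hm, hlm⟩ := List.isChain_append.1 h
    exact ⟨⟨hl, fun u hu => h₁ u (by simp [hu]), fun u hu => h₂ u (by simp [hu])⟩,
      ⟨hm, fun u hu => h₁ u (by simp [hu]), fun u hu => h₂ u (by simp [hu])⟩, key.1 hlm⟩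
  · rintro ⟨hl, hm, hlm⟩
    refine ⟨List.isChain_append.2 ⟨hl.chain, hm.chain, key.2 hlm⟩, fun u hu => ?_, fun v hv => ?_⟩
    · exact (List.mem_append.1 hu).elim (hl.left u) (hm.left u)
    · exact (List.mem_append.1 hv).elim (hl.right v) (hm.right v)

@[simp]
theorem isBlockSeq_inl {u : FreeSemigroup A₁} : IsBlockSeq R₁ R₂ [.inl u] ↔ u ∈ R₁ :=
  ⟨fun h => h.left u (by simp), fun h => ⟨by simp, by simpa, by simp⟩⟩

@[simp]
theorem isBlockSeq_inr {v : FreeSemigroup A₂} : IsBlockSeq R₁ R₂ [.inr v] ↔ v ∈ R₂ :=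
  ⟨fun h => h.right v (by simp), fun h => ⟨by simp, by simp, by simpa⟩⟩

theorem isBlockSeq_inl_cons {u : FreeSemigroup A₁}
    {l : List (FreeSemigroup A₁ ⊕ FreeSemigroup A₂)} :
    IsBlockSeq R₁ R₂ (.inl u :: l) ↔ u ∈ R₁ ∧ IsBlockSeq R₁ R₂ l ∧ headSide l ≠ some true := by
  rw [← List.singleton_append, isBlockSeq_append, isBlockSeq_inl]
  simp [lastSide]

theorem isBlockSeq_inr_cons {v : FreeSemigroup A₂}
    {l : List (FreeSemigroup A₁ ⊕ FreeSemigroup A₂)} :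
    IsBlockSeq R₁ R₂ (.inr v :: l) ↔ v ∈ R₂ ∧ IsBlockSeq R₁ R₂ l ∧ headSide l ≠ some false := by
  rw [← List.singleton_append, isBlockSeq_append, isBlockSeq_inr]
  simp [lastSide]

variable (R₁ R₂)

/-- The words spelled by block sequences, the first block of which is not from the factor `b`. -/
def blockLanguage (b : Bool) : Language (A₁ ⊕ A₂) :=
  {w | ∃ l, IsBlockSeq R₁ R₂ l ∧ headSide l ≠ some b ∧ w = blocksWord l}

local notation "X" => Language.map (Sum.inl : A₁ → A₁ ⊕ A₂) (FreeSemigroup.toWord '' R₁)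
local notation "Y" => Language.map (Sum.inr : A₂ → A₁ ⊕ A₂) (FreeSemigroup.toWord '' R₂)

theorem map_inl_mul_blockLanguage_le :
    X * blockLanguage R₁ R₂ true ≤ blockLanguage R₁ R₂ false := by
  rintro _ ⟨_, ⟨_, ⟨u, hu, rfl⟩, rfl⟩, _, ⟨l, hl, hb, rfl⟩, rfl⟩
  exact ⟨.inl u :: l, isBlockSeq_inl_cons.2 ⟨hu, hl, hb⟩, by simp [headSide], rfl⟩

theorem map_inr_mul_blockLanguage_le :
    Y * blockLanguage R₁ R₂ false ≤ blockLanguage R₁ R₂ true := by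
  rintro _ ⟨_, ⟨_, ⟨u, hu, rfl⟩, rfl⟩, _, ⟨l, hl, hb, rfl⟩, rfl⟩
  exact ⟨.inr u :: l, isBlockSeq_inr_cons.2 ⟨hu, hl, hb⟩, by simp [headSide], rfl⟩

theorem one_le_blockLanguage (b : Bool) : 1 ≤ blockLanguage R₁ R₂ b := by
  rintro _ rfl
  exact ⟨[], isBlockSeq_nil R₁ R₂, by simp [headSide], rfl⟩

/-- The right-hand side contains `L` and absorbs `M * L` on the right, so star induction applies. -/
theorem mul_kstar_mul_le {B : Type*} (L M : Language B) : L * (M * L)∗ ≤ (L * M)∗ * L := by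
  refine mul_kstar_le (le_mul_of_one_le_left' one_le_kstar) ?_
  calc (L * M)∗ * L * (M * L) = (L * M)∗ * (L * M) * L := by simp only [mul_assoc]
    _ ≤ _ := mul_le_mul' kstar_mul_le_kstar le_rfl

/-- This is the inductive step of `blocksWord_mem`: a word of `L` is put in front of an alternating
word that is empty or starts in `M`. -/
theorem mul_kstar_add_le {B : Type*} (L M : Language B) :
    L * ((M * L)∗ + (M * L)∗ * M) ≤ (L * M)∗ + (L * M)∗ * L := by
  rw [mul_add, ← mul_assoc]
  refine add_le (le_add_of_le_right (mul_kstar_mul_le L M)) (le_add_of_le_left ?_)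
  refine (mul_le_mul' (mul_kstar_mul_le L M) le_rfl).trans ?_
  rw [mul_assoc]
  exact kstar_mul_le_kstar

/-- The two halves need a joint induction, because removing the first block exchanges the roles of
the factors. -/
theorem blocksWord_mem {l : List (FreeSemigroup A₁ ⊕ FreeSemigroup A₂)}
    (hl : IsBlockSeq R₁ R₂ l) :
    (headSide l ≠ some false → blocksWord l ∈ (X * Y)∗ + (X * Y)∗ * X) ∧
      (headSide l ≠ some true → blocksWord l ∈ (Y * X)∗ + (Y * X)∗ * Y) := by
  induction l with
  | nil => exact ⟨fun _ => .inl (Language.nil_mem_kstar _), fun _ => .inl (Language.nil_mem_kstar _)⟩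
  | cons x l ih =>
    rcases x with u | v
    · obtain ⟨hu, hl, hb⟩ := isBlockSeq_inl_cons.1 hl
      refine ⟨fun _ => mul_kstar_add_le _ _ ?_, fun h => absurd rfl h⟩
      exact Language.append_mem_mul ⟨_, ⟨u, hu, rfl⟩, rfl⟩ ((ih hl).2 hb)
    · obtain ⟨hv, hl, hb⟩ := isBlockSeq_inr_cons.1 hl
      refine ⟨fun h => absurd rfl h, fun _ => mul_kstar_add_le _ _ ?_⟩
      exact Language.append_mem_mul ⟨_, ⟨v, hv, rfl⟩, rfl⟩ ((ih hl).1 hb)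

/-- From left to right this is star induction: each `blockLanguage` contains the empty word and
absorbs a pair of blocks on the left. The converse is `blocksWord_mem`. -/
theorem mem_altLanguage {w : List (A₁ ⊕ A₂)} :
    w ∈ altLanguage X Y ↔ ∃ l, IsBlockSeq R₁ R₂ l ∧ w = blocksWord l := by
  constructor
  · have h₁ : X * Y * blockLanguage R₁ R₂ false ≤ blockLanguage R₁ R₂ false := by
      rw [mul_assoc]
      exact (mul_le_mul' le_rfl (map_inr_mul_blockLanguage_le R₁ R₂)).trans
        (map_inl_mul_blockLanguage_le R₁ R₂)
    have h₂ : Y * X * blockLanguage R₁ R₂ true ≤ blockLanguage R₁ R₂ true := by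
      rw [mul_assoc]
      exact (mul_le_mul' le_rfl (map_inl_mul_blockLanguage_le R₁ R₂)).trans
        (map_inr_mul_blockLanguage_le R₁ R₂)
    have h₃ : (X * Y)∗ ≤ blockLanguage R₁ R₂ false := by
      simpa using kstar_mul_le (one_le_blockLanguage R₁ R₂ false) h₁
    have h₄ : (Y * X)∗ ≤ blockLanguage R₁ R₂ true := by
      simpa using kstar_mul_le (one_le_blockLanguage R₁ R₂ true) h₂
    have h₅ : (X * Y)∗ * X ≤ blockLanguage R₁ R₂ false :=
      kstar_mul_le ((le_mul_of_one_le_right' (one_le_blockLanguage R₁ R₂ true)).trans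
        (map_inl_mul_blockLanguage_le R₁ R₂)) h₁
    have h₆ : (Y * X)∗ * Y ≤ blockLanguage R₁ R₂ true :=
      kstar_mul_le ((le_mul_of_one_le_right' (one_le_blockLanguage R₁ R₂ false)).trans
        (map_inr_mul_blockLanguage_le R₁ R₂)) h₂
    have key : ∀ b, w ∈ blockLanguage R₁ R₂ b → ∃ l, IsBlockSeq R₁ R₂ l ∧ w = blocksWord l :=
      fun b ⟨l, hl, _, hw⟩ => ⟨l, hl, hw⟩
    rintro (((h | h) | h) | h)
    exacts [key _ (h₃ h), key _ (h₄ h), key _ (h₅ h), key _ (h₆ h)]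
  · rintro ⟨l, hl, rfl⟩
    by_cases hb : headSide l = some false
    · rcases (blocksWord_mem R₁ R₂ hl).2 (by simp [hb]) with h | h
      exacts [.inl (.inl (.inr h)), .inr h]
    · rcases (blocksWord_mem R₁ R₂ hl).1 hb with h | h
      exacts [.inl (.inl (.inl h)), .inl (.inr h)]

theorem mem_altPlus {w : FreeSemigroup (A₁ ⊕ A₂)} :
    w ∈ altPlus R₁ R₂ ↔ ∃ l, IsBlockSeq R₁ R₂ l ∧ w.toWord = blocksWord l :=
  mem_altLanguage R₁ R₂

end Blocks

/-! ### Regularity of the alternating words -/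

section Regular

theorem isRegular_getLast {A : Type*} [Finite A] (f : Option A → Prop) :
    Language.IsRegular ({w | f w.getLast?} : Set (List A)) := by
  let M : DFA A (Option A) := { step := fun _ a => some a, start := none, accept := {o | f o} }
  have := Fintype.ofFinite A
  refine Language.isRegular_iff.2 ⟨Option A, inferInstance, M, ?_⟩
  have key : ∀ w, M.eval w = w.getLast? := fun w => by
    induction w using List.reverseRecOn with
    | nil => rfl
    | append_singleton w a _ => simp [M]
  ext w
  rw [DFA.mem_accepts, key]
  rfl

theorem isRegular_head {A : Type*} [Finite A] (f : Option A → Prop) :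
    Language.IsRegular ({w | f w.head?} : Set (List A)) := by
  have h : ({w | f w.head?} : Set (List A)) =
      Language.reverse ({w | f w.getLast?} : Set (List A)) := by
    ext w
    change f w.head? ↔ f w.reverse.getLast?
    rw [List.getLast?_reverse]
  rw [h]
  exact (isRegular_getLast f).reverse

variable {A₁ A₂ σ₁ σ₂ : Type*} (M₁ : DFA A₁ σ₁) (M₂ : DFA A₂ σ₂)

open Classical in
/-- An automaton for the alternating words: it runs `M₁` and `M₂` in turn. The state `inl true` is
the start, and `inl false` is a sink. -/
noncomputable def altDFA : DFA (A₁ ⊕ A₂) (Bool ⊕ (σ₁ ⊕ σ₂)) where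
  step
    | .inl true, .inl a => .inr (.inl (M₁.step M₁.start a))
    | .inl true, .inr b => .inr (.inr (M₂.step M₂.start b))
    | .inl false, _ => .inl false
    | .inr (.inl q), .inl a => .inr (.inl (M₁.step q a))
    | .inr (.inl q), .inr b =>
      if q ∈ M₁.accept then .inr (.inr (M₂.step M₂.start b)) else .inl false
    | .inr (.inr q), .inr b => .inr (.inr (M₂.step q b))
    | .inr (.inr q), .inl a =>
      if q ∈ M₂.accept then .inr (.inl (M₁.step M₁.start a)) else .inl false
  start := .inl true
  accept := {s | Sum.elim (· = true) (Sum.elim (· ∈ M₁.accept) (· ∈ M₂.accept)) s}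

theorem altDFA_evalFrom_sink (w : List (A₁ ⊕ A₂)) :
    (altDFA M₁ M₂).evalFrom (.inl false) w = .inl false := by
  induction w with
  | nil => rfl
  | cons a w ih => exact ih

variable {M₁ M₂} {R₁ : Set (FreeSemigroup A₁)} {R₂ : Set (FreeSemigroup A₂)}

/-- Inside a block, the remaining input first completes that block by a possibly empty `p` and then
starts afresh in the other factor. Since the alphabets are disjoint, the next letter alone decides
whether the block goes on. Reading a letter may switch the factor, so both claims are proved in one
induction. -/
theorem mem_acceptsFrom_altDFA (h₁ : M₁.accepts = FreeSemigroup.toWord '' R₁)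
    (h₂ : M₂.accepts = FreeSemigroup.toWord '' R₂) (w : List (A₁ ⊕ A₂)) :
    (∀ q, w ∈ (altDFA M₁ M₂).acceptsFrom (.inr (.inl q)) ↔ ∃ p ∈ M₁.acceptsFrom q,
      ∃ l, IsBlockSeq R₁ R₂ l ∧ headSide l ≠ some true ∧ w = p.map .inl ++ blocksWord l) ∧
    (∀ q, w ∈ (altDFA M₁ M₂).acceptsFrom (.inr (.inr q)) ↔ ∃ p ∈ M₂.acceptsFrom q,
      ∃ l, IsBlockSeq R₁ R₂ l ∧ headSide l ≠ some false ∧ w = p.map .inr ++ blocksWord l) := by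
  have mem₁ (u : FreeSemigroup A₁) : u.toWord ∈ M₁.accepts ↔ u ∈ R₁ := by
    rw [h₁]; exact FreeSemigroup.toWord_injective.mem_set_image
  have mem₂ (u : FreeSemigroup A₂) : u.toWord ∈ M₂.accepts ↔ u ∈ R₂ := by
    rw [h₂]; exact FreeSemigroup.toWord_injective.mem_set_image
  have sink (w : List (A₁ ⊕ A₂)) : ¬ w ∈ (altDFA M₁ M₂).acceptsFrom (.inl false) := by
    rw [DFA.mem_acceptsFrom, altDFA_evalFrom_sink]
    exact Bool.false_ne_true
  induction w with
  | nil =>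
    refine ⟨fun q => ⟨fun h => ⟨[], h, [], isBlockSeq_nil _ _, by simp [headSide], rfl⟩, ?_⟩,
      fun q => ⟨fun h => ⟨[], h, [], isBlockSeq_nil _ _, by simp [headSide], rfl⟩, ?_⟩⟩
    all_goals
      rintro ⟨p, hp, l, _, _, h⟩
      obtain rfl : p = [] := by simpa using (List.append_eq_nil_iff.1 h.symm).1
      exact hp
  | cons x w ih =>
    rcases x with a | b
    · refine ⟨fun q => ?_, fun q => ?_⟩
      · refine (ih.1 (M₁.step q a)).trans ⟨?_, ?_⟩
        · rintro ⟨p, hp, l, hl, hb, rfl⟩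
          exact ⟨a :: p, hp, l, hl, hb, rfl⟩
        · rintro ⟨p, hp, l, hl, hb, h⟩
          rcases p with _ | ⟨a', p⟩
          · refine absurd ?_ hb
            rw [← headSide_blocksWord, ← show _ = blocksWord l from h]
            rfl
          · simp only [List.map_cons, List.cons_append, List.cons.injEq, Sum.inl.injEq] at h
            obtain ⟨rfl, rfl⟩ := h
            exact ⟨p, hp, l, hl, hb, rfl⟩
      -- A letter of the other alphabet closes the current block, which is allowed only in an
      -- accepting state; otherwise the run is lost in the sink.
      · have step : Sum.inl a :: w ∈ (altDFA M₁ M₂).acceptsFrom (.inr (.inr q)) ↔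
            q ∈ M₂.accept ∧
              w ∈ (altDFA M₁ M₂).acceptsFrom (.inr (.inl (M₁.step M₁.start a))) := by
          by_cases hq : q ∈ M₂.accept
          · simp [DFA.mem_acceptsFrom, altDFA, hq]
          · have := sink w
            simp only [DFA.mem_acceptsFrom] at this
            simpa [DFA.mem_acceptsFrom, altDFA, hq] using this
        rw [step, ih.1]
        constructor
        · rintro ⟨hq, p, hp, l, hl, hb, rfl⟩
          exact ⟨[], hq, .inl ⟨a, p⟩ :: l,
            isBlockSeq_inl_cons.2 ⟨(mem₁ ⟨a, p⟩).1 hp, hl, hb⟩, by simp [headSide], rfl⟩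
        · rintro ⟨p, hp, l, hl, hb, h⟩
          rcases p with _ | ⟨b, p⟩
          · rcases l with _ | ⟨⟨a', u⟩ | v, l⟩
            · cases h
            · obtain ⟨hu, hl', hb'⟩ := isBlockSeq_inl_cons.1 hl
              simp only [List.map_nil, List.nil_append, blocksWord_cons, blockWord,
                FreeSemigroup.toWord, List.map_cons, List.cons_append, List.cons.injEq,
                Sum.inl.injEq] at h
              obtain ⟨rfl, rfl⟩ := h
              exact ⟨hp, u, (mem₁ ⟨a, u⟩).2 hu, l, hl', hb', rfl⟩
            · exact absurd rfl hb
          · simp at h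
    · refine ⟨fun q => ?_, fun q => ?_⟩
      · have step : Sum.inr b :: w ∈ (altDFA M₁ M₂).acceptsFrom (.inr (.inl q)) ↔
            q ∈ M₁.accept ∧
              w ∈ (altDFA M₁ M₂).acceptsFrom (.inr (.inr (M₂.step M₂.start b))) := by
          by_cases hq : q ∈ M₁.accept
          · simp [DFA.mem_acceptsFrom, altDFA, hq]
          · have := sink w
            simp only [DFA.mem_acceptsFrom] at this
            simpa [DFA.mem_acceptsFrom, altDFA, hq] using this
        rw [step, ih.2]
        constructor
        · rintro ⟨hq, p, hp, l, hl, hb, rfl⟩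
          exact ⟨[], hq, .inr ⟨b, p⟩ :: l,
            isBlockSeq_inr_cons.2 ⟨(mem₂ ⟨b, p⟩).1 hp, hl, hb⟩, by simp [headSide], rfl⟩
        · rintro ⟨p, hp, l, hl, hb, h⟩
          rcases p with _ | ⟨a, p⟩
          · rcases l with _ | ⟨u | ⟨b', v⟩, l⟩
            · cases h
            · exact absurd rfl hb
            · obtain ⟨hv, hl', hb'⟩ := isBlockSeq_inr_cons.1 hl
              simp only [List.map_nil, List.nil_append, blocksWord_cons, blockWord,
                FreeSemigroup.toWord, List.map_cons, List.cons_append, List.cons.injEq,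
                Sum.inr.injEq] at h
              obtain ⟨rfl, rfl⟩ := h
              exact ⟨hp, v, (mem₂ ⟨b, v⟩).2 hv, l, hl', hb', rfl⟩
          · simp at h
      · refine (ih.2 (M₂.step q b)).trans ⟨?_, ?_⟩
        · rintro ⟨p, hp, l, hl, hb, rfl⟩
          exact ⟨b :: p, hp, l, hl, hb, rfl⟩
        · rintro ⟨p, hp, l, hl, hb, h⟩
          rcases p with _ | ⟨b', p⟩
          · refine absurd ?_ hb
            rw [← headSide_blocksWord, ← show _ = blocksWord l from h]
            rfl
          · simp only [List.map_cons, List.cons_append, List.cons.injEq, Sum.inr.injEq] at h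
            obtain ⟨rfl, rfl⟩ := h
            exact ⟨p, hp, l, hl, hb, rfl⟩

theorem accepts_altDFA (h₁ : M₁.accepts = FreeSemigroup.toWord '' R₁)
    (h₂ : M₂.accepts = FreeSemigroup.toWord '' R₂) :
    (altDFA M₁ M₂).accepts = {w | ∃ l, IsBlockSeq R₁ R₂ l ∧ w = blocksWord l} := by
  have mem₁ (u : FreeSemigroup A₁) : u.toWord ∈ M₁.accepts ↔ u ∈ R₁ := by
    rw [h₁]; exact FreeSemigroup.toWord_injective.mem_set_image
  have mem₂ (u : FreeSemigroup A₂) : u.toWord ∈ M₂.accepts ↔ u ∈ R₂ := by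
    rw [h₂]; exact FreeSemigroup.toWord_injective.mem_set_image
  ext w
  rcases w with _ | ⟨a | b, w⟩
  · exact ⟨fun _ => ⟨[], isBlockSeq_nil _ _, rfl⟩, fun _ => rfl⟩
  · refine ((mem_acceptsFrom_altDFA h₁ h₂ w).1 (M₁.step M₁.start a)).trans ⟨?_, ?_⟩
    · rintro ⟨p, hp, l, hl, hb, rfl⟩
      exact ⟨.inl ⟨a, p⟩ :: l, isBlockSeq_inl_cons.2 ⟨(mem₁ ⟨a, p⟩).1 hp, hl, hb⟩, rfl⟩
    · rintro ⟨_ | ⟨⟨a', u⟩ | v, l⟩, hl, h⟩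
      · cases h
      · obtain ⟨hu, hl', hb'⟩ := isBlockSeq_inl_cons.1 hl
        simp only [blocksWord_cons, blockWord, FreeSemigroup.toWord, List.map_cons,
          List.cons_append, List.cons.injEq, Sum.inl.injEq] at h
        obtain ⟨rfl, rfl⟩ := h
        exact ⟨u, (mem₁ ⟨a, u⟩).2 hu, l, hl', hb', rfl⟩
      · simp [blockWord, FreeSemigroup.toWord] at h
  · refine ((mem_acceptsFrom_altDFA h₁ h₂ w).2 (M₂.step M₂.start b)).trans ⟨?_, ?_⟩
    · rintro ⟨p, hp, l, hl, hb, rfl⟩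
      exact ⟨.inr ⟨b, p⟩ :: l, isBlockSeq_inr_cons.2 ⟨(mem₂ ⟨b, p⟩).1 hp, hl, hb⟩, rfl⟩
    · rintro ⟨_ | ⟨u | ⟨b', v⟩, l⟩, hl, h⟩
      · cases h
      · simp [blockWord, FreeSemigroup.toWord] at h
      · obtain ⟨hv, hl', hb'⟩ := isBlockSeq_inr_cons.1 hl
        simp only [blocksWord_cons, blockWord, FreeSemigroup.toWord, List.map_cons,
          List.cons_append, List.cons.injEq, Sum.inr.injEq] at h
        obtain ⟨rfl, rfl⟩ := h
        exact ⟨v, (mem₂ ⟨b, v⟩).2 hv, l, hl', hb', rfl⟩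

theorem isRegular_blocksWord (h₁ : Language.IsRegular (FreeSemigroup.toWord '' R₁ : Set (List A₁)))
    (h₂ : Language.IsRegular (FreeSemigroup.toWord '' R₂ : Set (List A₂))) :
    Language.IsRegular ({w | ∃ l, IsBlockSeq R₁ R₂ l ∧ w = blocksWord l} :
      Set (List (A₁ ⊕ A₂))) := by
  obtain ⟨σ₁, _, M₁, h₁⟩ := h₁
  obtain ⟨σ₂, _, M₂, h₂⟩ := h₂
  exact ⟨_, inferInstance, altDFA M₁ M₂, accepts_altDFA h₁ h₂⟩

variable (R₁ R₂) in
/-- The words spelled by block sequences with a condition on the factors of the first and the last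
block. -/
def sidedLanguage (f g : Option Bool → Prop) : Language (A₁ ⊕ A₂) :=
  {w | ∃ l, IsBlockSeq R₁ R₂ l ∧ f (headSide l) ∧ g (lastSide l) ∧ w = blocksWord l}

/-- The factors of the end blocks can be read off the first and last letters, so this is an
intersection of three regular languages. -/
theorem isRegular_sidedLanguage [Finite A₁] [Finite A₂]
    (h₁ : Language.IsRegular (FreeSemigroup.toWord '' R₁ : Set (List A₁)))
    (h₂ : Language.IsRegular (FreeSemigroup.toWord '' R₂ : Set (List A₂)))
    (f g : Option Bool → Prop) : (sidedLanguage R₁ R₂ f g).IsRegular := by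
  have := ((isRegular_blocksWord h₁ h₂).inf (isRegular_head fun o => f (o.map Sum.isLeft))).inf
    (isRegular_getLast fun o => g (o.map Sum.isLeft))
  convert! this using 1
  ext w
  constructor
  · rintro ⟨l, hl, hf, hg, rfl⟩
    rw [← headSide_blocksWord] at hf
    rw [← lastSide_blocksWord] at hg
    exact ⟨⟨⟨l, hl, rfl⟩, hf⟩, hg⟩
  · rintro ⟨⟨⟨l, hl, rfl⟩, hf⟩, hg⟩
    exact ⟨l, hl, headSide_blocksWord l ▸ hf, lastSide_blocksWord l ▸ hg, rfl⟩

end Regular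

/-! ### The combing of the free product -/

section Combing

variable {S₁ S₂ : Type*} [Semigroup S₁] [Semigroup S₂] {A₁ A₂ : Type*}

theorem altCons_inl_altCons_inl (a b : S₁) (l : List (S₁ ⊕ S₂)) :
    altCons (.inl a) (altCons (.inl b) l) = altCons (.inl (a * b)) l := by
  rcases l with _ | ⟨c | c, l⟩ <;> simp [altCons, mul_assoc]

theorem altCons_inr_altCons_inr (a b : S₂) (l : List (S₁ ⊕ S₂)) :
    altCons (.inr a) (altCons (.inr b) l) = altCons (.inr (a * b)) l := by
  rcases l with _ | ⟨c | c, l⟩ <;> simp [altCons, mul_assoc]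

/-- A merge does not cascade: the product stays in the factor of `a` and `b`, so its neighbours
still come from the other one. -/
theorem alternatise_inl_inl {s t : List (S₁ ⊕ S₂)} {a b : S₁}
    (h : (s ++ .inl (a * b) :: t).IsChain DiffFactor) :
    alternatise (s ++ .inl a :: .inl b :: t) = s ++ .inl (a * b) :: t := by
  rw [← alternatise_of_isChain h, alternatise_append, alternatise_append]
  exact congrArg (s.foldr altCons) (altCons_inl_altCons_inl a b _)

theorem alternatise_inr_inr {s t : List (S₁ ⊕ S₂)} {a b : S₂}
    (h : (s ++ .inr (a * b) :: t).IsChain DiffFactor) :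
    alternatise (s ++ .inr a :: .inr b :: t) = s ++ .inr (a * b) :: t := by
  rw [← alternatise_of_isChain h, alternatise_append, alternatise_append]
  exact congrArg (s.foldr altCons) (altCons_inr_altCons_inr a b _)

theorem isChain_map_sumMap {X Y X' Y' : Type*} (f : X → X') (g : Y → Y') {l : List (X ⊕ Y)} :
    (l.map (Sum.map f g)).IsChain DiffFactor ↔ l.IsChain DiffFactor := by
  rw [List.isChain_map]
  simp only [DiffFactor, Sum.isLeft_map]
  rfl

variable (π₁ : FreeSemigroup A₁ →ₙ* S₁) (π₂ : FreeSemigroup A₂ →ₙ* S₂)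

theorem FreeSemigroup.toWord_map {A B : Type*} (f : A → B) (u : FreeSemigroup A) :
    (FreeSemigroup.map f u).toWord = u.toWord.map f := by
  induction u using FreeSemigroup.recOnMul with
  | ih1 a => rfl
  | ih2 a u _ ih => rw [map_mul, FreeSemigroup.toWord_mul, FreeSemigroup.toWord_mul, ih]; rfl

theorem wordHom_map_inl (u : FreeSemigroup A₁) :
    SgpFreeProduct.wordHom π₁ π₂ (FreeSemigroup.map .inl u) =
      SgpFreeProduct.of (.inl (π₁ u)) := by
  induction u using FreeSemigroup.recOnMul with
  | ih1 a => rfl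
  | ih2 a u h ih =>
    rw [map_mul, map_mul, h, ih, map_mul]
    rfl

theorem wordHom_map_inr (v : FreeSemigroup A₂) :
    SgpFreeProduct.wordHom π₁ π₂ (FreeSemigroup.map .inr v) =
      SgpFreeProduct.of (.inr (π₂ v)) := by
  induction v using FreeSemigroup.recOnMul with
  | ih1 a => rfl
  | ih2 a u h ih =>
    rw [map_mul, map_mul, h, ih, map_mul]
    rfl

theorem wordHom_of_toWord_eq_blockWord {x : FreeSemigroup A₁ ⊕ FreeSemigroup A₂}
    {w : FreeSemigroup (A₁ ⊕ A₂)} (hw : w.toWord = blockWord x) :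
    SgpFreeProduct.wordHom π₁ π₂ w = SgpFreeProduct.of (Sum.map π₁ π₂ x) := by
  rcases x with u | v
  · obtain rfl : w = FreeSemigroup.map .inl u :=
      FreeSemigroup.toWord_injective (hw.trans (FreeSemigroup.toWord_map _ u).symm)
    exact wordHom_map_inl π₁ π₂ u
  · obtain rfl : w = FreeSemigroup.map .inr v :=
      FreeSemigroup.toWord_injective (hw.trans (FreeSemigroup.toWord_map _ v).symm)
    exact wordHom_map_inr π₁ π₂ v

/-- Each block evaluates to a one-term sequence, and consecutive ones lie in different factors, so
multiplying them is plain concatenation. -/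
theorem seq_wordHom {l : List (FreeSemigroup A₁ ⊕ FreeSemigroup A₂)}
    (hl : l.IsChain DiffFactor) {w : FreeSemigroup (A₁ ⊕ A₂)} (hw : w.toWord = blocksWord l) :
    (SgpFreeProduct.wordHom π₁ π₂ w).seq = l.map (Sum.map π₁ π₂) := by
  induction l generalizing w with
  | nil => exact absurd hw w.toWord_ne_nil
  | cons x l ih =>
    -- A free semigroup has no empty word, so a single block cannot be split off from an empty rest.
    obtain rfl | hne := eq_or_ne l []
    · rw [wordHom_of_toWord_eq_blockWord π₁ π₂ (x := x) (by simpa using hw)]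
      rfl
    · obtain ⟨v, hv⟩ := FreeSemigroup.exists_toWord_eq (mt blocksWord_eq_nil.1 hne)
      obtain ⟨u, hu⟩ : ∃ u : FreeSemigroup (A₁ ⊕ A₂), u.toWord = blockWord x :=
        FreeSemigroup.exists_toWord_eq fun h =>
          List.cons_ne_nil x [] (blocksWord_eq_nil.1 (by simpa using h))
      obtain rfl : w = u * v := FreeSemigroup.toWord_injective
        (by rw [hw, FreeSemigroup.toWord_mul, hu, hv, blocksWord_cons])
      rw [map_mul, SgpFreeProduct.seq_mul_eq_foldr, ih hl.tail hv,
        wordHom_of_toWord_eq_blockWord π₁ π₂ hu]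
      exact altCons_of_isChain ((isChain_map_sumMap π₁ π₂ (l := x :: l)).2 hl)

variable {π₁ π₂} {R₁ : Set (FreeSemigroup A₁)} {R₂ : Set (FreeSemigroup A₂)}

theorem IsBlockSeq.eq_of_map_eq (h₁ : Set.InjOn π₁ R₁) (h₂ : Set.InjOn π₂ R₂)
    {l m : List (FreeSemigroup A₁ ⊕ FreeSemigroup A₂)} (hl : IsBlockSeq R₁ R₂ l)
    (hm : IsBlockSeq R₁ R₂ m) (h : l.map (Sum.map π₁ π₂) = m.map (Sum.map π₁ π₂)) : l = m := by
  induction l generalizing m with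
  | nil => exact (List.map_eq_nil_iff.1 h.symm).symm
  | cons x l ih =>
    rcases m with _ | ⟨y, m⟩
    · simp at h
    · obtain ⟨hxy, hlm⟩ := List.cons.inj h
      rcases x with u | u <;> rcases y with v | v
      · obtain ⟨hu, hl, _⟩ := isBlockSeq_inl_cons.1 hl
        obtain ⟨hv, hm, _⟩ := isBlockSeq_inl_cons.1 hm
        rw [h₁ hu hv (Sum.inl.inj hxy), ih hl hm hlm]
      · cases hxy
      · cases hxy
      · obtain ⟨hu, hl, _⟩ := isBlockSeq_inr_cons.1 hl
        obtain ⟨hv, hm, _⟩ := isBlockSeq_inr_cons.1 hm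
        rw [h₂ hu hv (Sum.inr.inj hxy), ih hl hm hlm]

/-- Evaluation is entrywise, so injectivity is checked block by block, and a preimage is spelled by
choosing a representative of each entry. -/
theorem bijOn_altPlus (h₁ : Set.BijOn π₁ R₁ Set.univ) (h₂ : Set.BijOn π₂ R₂ Set.univ) :
    Set.BijOn (SgpFreeProduct.wordHom π₁ π₂) (altPlus R₁ R₂) Set.univ := by
  refine ⟨Set.mapsTo_univ _ _, ?_, ?_⟩
  · intro u hu v hv huv
    obtain ⟨l, hl, hul⟩ := (mem_altPlus R₁ R₂).1 hu
    obtain ⟨m, hm, hvm⟩ := (mem_altPlus R₁ R₂).1 hv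
    have := congrArg SgpFreeProduct.seq huv
    rw [seq_wordHom π₁ π₂ hl.chain hul, seq_wordHom π₁ π₂ hm.chain hvm] at this
    obtain rfl := hl.eq_of_map_eq h₁.injOn h₂.injOn hm this
    exact FreeSemigroup.toWord_injective (hul.trans hvm.symm)
  · intro s _
    choose r₁ hr₁ hπ₁ using fun a => h₁.surjOn (Set.mem_univ a)
    choose r₂ hr₂ hπ₂ using fun a => h₂.surjOn (Set.mem_univ a)
    have hl : IsBlockSeq R₁ R₂ (s.seq.map (Sum.map r₁ r₂)) := by
      refine ⟨(isChain_map_sumMap r₁ r₂).2 s.alternating, fun u hu => ?_, fun v hv => ?_⟩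
      · obtain ⟨a | a, -, ha⟩ := List.mem_map.1 hu <;> cases ha
        exact hr₁ a
      · obtain ⟨a | a, -, ha⟩ := List.mem_map.1 hv <;> cases ha
        exact hr₂ a
    obtain ⟨w, hw⟩ := FreeSemigroup.exists_toWord_eq
      (mt blocksWord_eq_nil.1 (mt List.map_eq_nil_iff.1 s.ne_nil) :
        blocksWord (s.seq.map (Sum.map r₁ r₂)) ≠ [])
    refine ⟨w, (mem_altPlus R₁ R₂).2 ⟨_, hl, hw⟩, SgpFreeProduct.ext ?_⟩
    rw [seq_wordHom π₁ π₂ hl.chain hw, List.map_map, List.map_congr_left (g := id), List.map_id]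
    rintro (a | a) _ <;> simp [hπ₁, hπ₂]

theorem isRegular_altPlus [Finite A₁] [Finite A₂]
    (h₁ : Language.IsRegular (FreeSemigroup.toWord '' R₁ : Set (List A₁)))
    (h₂ : Language.IsRegular (FreeSemigroup.toWord '' R₂ : Set (List A₂))) :
    Language.IsRegular (FreeSemigroup.toWord '' altPlus R₁ R₂ : Set (List (A₁ ⊕ A₂))) := by
  -- The condition `≠ none` on the last side removes exactly the empty word.
  suffices h : (FreeSemigroup.toWord '' altPlus R₁ R₂ : Set (List (A₁ ⊕ A₂))) =
      sidedLanguage R₁ R₂ (fun _ => True) (· ≠ none) by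
    rw [h]
    exact isRegular_sidedLanguage h₁ h₂ _ _
  ext w
  constructor
  · rintro ⟨w, hw, rfl⟩
    obtain ⟨l, hl, h⟩ := (mem_altPlus R₁ R₂).1 hw
    refine ⟨l, hl, trivial, ?_, h⟩
    rw [← lastSide_blocksWord, ← h]
    simp [lastSide, w.toWord_ne_nil]
  · rintro ⟨l, hl, -, hne, rfl⟩
    obtain ⟨w, hw⟩ := FreeSemigroup.exists_toWord_eq
      (mt blocksWord_eq_nil.1 fun h => hne (by rw [h]; rfl) : blocksWord l ≠ [])
    exact ⟨w, (mem_altPlus R₁ R₂).2 ⟨l, hl, hw⟩, hw⟩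

end Combing

/-! ### The multiplication table of the free product -/

section Table

open Language

variable {A B S : Type*} [Semigroup S]

/-- The substitution that embeds the letters by `f` and puts words `q #₂ q^rev` with `q ∈ Q` in
place of `#₂`. -/
def tableSubst (f : A → B) (Q : Language B) : A ⊕ Separator → Language (B ⊕ Separator)
  | .inl a => {[.inl (f a)]}
  | .inr .one => {[.inr .one]}
  | .inr .two => Q.sandwich .inl {[.inr .two]}

theorem isContextFree_tableSubst [Finite B] (f : A → B) {Q : Language B} (hQ : Q.IsRegular) :
    ∀ x, (tableSubst f Q x).IsContextFree
  | .inl _ => isContextFree_singleton _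
  | .inr .one => isContextFree_singleton _
  | .inr .two => IsContextFree.sandwich hQ _ (isContextFree_singleton _)

/-- Putting `q #₂ q^rev` for `#₂` appends the same `q` to the second factor and to the result, since
`q^rev w^rev` is the reverse of `w q`. The outer sandwich of the next lemma likewise prepends `p` to
the first factor and to the result. -/
theorem mem_subst_multTable {π : FreeSemigroup A →ₙ* S} {R : Set (FreeSemigroup A)} {f : A → B}
    {Q : Language B} {z : List (B ⊕ Separator)} :
    z ∈ (multTable π R).subst (tableSubst f Q) ↔
      ∃ u ∈ R, ∃ v ∈ R, ∃ w ∈ R, π u * π v = π w ∧ ∃ q ∈ Q,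
        z = (u.toWord.map f).map .inl ++ [.inr .one] ++ (v.toWord.map f ++ q).map .inl ++
          [.inr .two] ++ ((w.toWord.map f ++ q).map .inl).reverse := by
  have key (u : List A) : ((u.map Sum.inl).map (tableSubst f Q)).prod =
      {(u.map f).map Sum.inl} := by
    have := prod_map_singleton u fun a => (Sum.inl (f a) : B ⊕ Separator)
    rw [List.map_map, List.map_map]
    exact this
  have table (u v w : FreeSemigroup A) : ((tableWord u v w).map (tableSubst f Q)).prod =
      {(u.toWord.map f).map .inl} * {[.inr .one]} * {(v.toWord.map f).map .inl} *
        Q.sandwich .inl {[.inr .two]} * {((w.toWord.map f).map .inl).reverse} := by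
    simp only [tableWord, List.map_append, List.prod_append, ← List.map_reverse, key]
    simp [tableSubst]
  constructor
  · rintro ⟨_, ⟨u, hu, v, hv, w, hw, h, rfl⟩, hz⟩
    rw [table] at hz
    simp only [singleton_mul_singleton] at hz
    obtain ⟨_, ⟨_, rfl, _, ⟨q, hq, _, rfl, rfl⟩, rfl⟩, _, rfl, rfl⟩ := hz
    exact ⟨u, hu, v, hv, w, hw, h, q, hq, by simp⟩
  · rintro ⟨u, hu, v, hv, w, hw, h, q, hq, rfl⟩
    refine ⟨_, ⟨u, hu, v, hv, w, hw, h, rfl⟩, ?_⟩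
    rw [table]
    simp only [singleton_mul_singleton]
    exact ⟨_, ⟨_, rfl, _, ⟨q, hq, _, rfl, rfl⟩, rfl⟩, _, rfl, by simp⟩

theorem mem_sandwich_subst_multTable {π : FreeSemigroup A →ₙ* S} {R : Set (FreeSemigroup A)}
    {f : A → B} {P Q : Language B} {z : List (B ⊕ Separator)} :
    z ∈ P.sandwich .inl ((multTable π R).subst (tableSubst f Q)) ↔
      ∃ p ∈ P, ∃ u ∈ R, ∃ v ∈ R, ∃ w ∈ R, π u * π v = π w ∧ ∃ q ∈ Q,
        z = (p ++ u.toWord.map f).map .inl ++ [.inr .one] ++ (v.toWord.map f ++ q).map .inl ++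
          [.inr .two] ++ ((p ++ w.toWord.map f ++ q).map .inl).reverse := by
  constructor
  · rintro ⟨p, hp, _, hd, rfl⟩
    obtain ⟨u, hu, v, hv, w, hw, h, q, hq, rfl⟩ := mem_subst_multTable.1 hd
    exact ⟨p, hp, u, hu, v, hv, w, hw, h, q, hq, by simp⟩
  · rintro ⟨p, hp, u, hu, v, hv, w, hw, h, q, hq, rfl⟩
    exact ⟨p, hp, _, mem_subst_multTable.2 ⟨u, hu, v, hv, w, hw, h, q, hq, rfl⟩, by simp⟩

/-- The words `p #₁ q #₂ (p q)^rev` with `p ∈ P` and `q ∈ Q`. -/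
def concatTable (P Q : Language B) : Language (B ⊕ Separator) :=
  P.sandwich .inl ({[.inr .one]} * Q.sandwich .inl {[.inr .two]})

theorem mem_concatTable {P Q : Language B} {z : List (B ⊕ Separator)} :
    z ∈ concatTable P Q ↔ ∃ p ∈ P, ∃ q ∈ Q,
      z = p.map .inl ++ [.inr .one] ++ q.map .inl ++ [.inr .two] ++
        ((p ++ q).map .inl).reverse := by
  constructor
  · rintro ⟨p, hp, _, ⟨_, rfl, _, ⟨q, hq, _, rfl, rfl⟩, rfl⟩, rfl⟩
    exact ⟨p, hp, q, hq, by simp⟩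
  · rintro ⟨p, hp, q, hq, rfl⟩
    exact ⟨p, hp, _, ⟨_, rfl, _, ⟨q, hq, _, rfl, rfl⟩, rfl⟩, by simp⟩

theorem isContextFree_concatTable [Finite B] {P Q : Language B} (hP : P.IsRegular)
    (hQ : Q.IsRegular) : (concatTable P Q).IsContextFree :=
  .sandwich hP _ ((isContextFree_singleton _).mul (.sandwich hQ _ (isContextFree_singleton _)))

variable {S₁ S₂ : Type*} [Semigroup S₁] [Semigroup S₂] {A₁ A₂ : Type*}
  {π₁ : FreeSemigroup A₁ →ₙ* S₁} {π₂ : FreeSemigroup A₂ →ₙ* S₂}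
  {R₁ : Set (FreeSemigroup A₁)} {R₂ : Set (FreeSemigroup A₂)}

/-- Only `l` and `m` have to be required non-empty; for `k` this follows from `alternatise_ne_nil`.
-/
theorem mem_multTable_altPlus {z : List ((A₁ ⊕ A₂) ⊕ Separator)} :
    z ∈ multTable (SgpFreeProduct.wordHom π₁ π₂) (altPlus R₁ R₂) ↔
      ∃ l m k, IsBlockSeq R₁ R₂ l ∧ IsBlockSeq R₁ R₂ m ∧ IsBlockSeq R₁ R₂ k ∧ l ≠ [] ∧ m ≠ [] ∧
        alternatise ((l ++ m).map (Sum.map π₁ π₂)) = k.map (Sum.map π₁ π₂) ∧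
        z = (blocksWord l).map .inl ++ [.inr .one] ++ (blocksWord m).map .inl ++ [.inr .two] ++
          ((blocksWord k).map .inl).reverse := by
  have ne_nil {l : List (FreeSemigroup A₁ ⊕ FreeSemigroup A₂)} {w : FreeSemigroup (A₁ ⊕ A₂)}
      (h : w.toWord = blocksWord l) : l ≠ [] := by
    rintro rfl
    exact w.toWord_ne_nil h
  constructor
  · rintro ⟨u, hu, v, hv, w, hw, h, rfl⟩
    obtain ⟨l, hl, hul⟩ := (mem_altPlus R₁ R₂).1 hu
    obtain ⟨m, hm, hvm⟩ := (mem_altPlus R₁ R₂).1 hv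
    obtain ⟨k, hk, hwk⟩ := (mem_altPlus R₁ R₂).1 hw
    refine ⟨l, m, k, hl, hm, hk, ne_nil hul, ne_nil hvm, ?_, ?_⟩
    · rw [← seq_wordHom π₁ π₂ hk.chain hwk, ← h, SgpFreeProduct.seq_mul,
        seq_wordHom π₁ π₂ hl.chain hul, seq_wordHom π₁ π₂ hm.chain hvm, List.map_append]
    · rw [← hul, ← hvm, ← hwk, tableWord]
  · rintro ⟨l, m, k, hl, hm, hk, hl', hm', h, rfl⟩
    have hk' : k ≠ [] := by
      rintro rfl
      exact alternatise_ne_nil (by simp [hl']) h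
    obtain ⟨u, hu⟩ := FreeSemigroup.exists_toWord_eq (mt blocksWord_eq_nil.1 hl')
    obtain ⟨v, hv⟩ := FreeSemigroup.exists_toWord_eq (mt blocksWord_eq_nil.1 hm')
    obtain ⟨w, hw⟩ := FreeSemigroup.exists_toWord_eq (mt blocksWord_eq_nil.1 hk')
    refine ⟨u, (mem_altPlus R₁ R₂).2 ⟨l, hl, hu⟩, v, (mem_altPlus R₁ R₂).2 ⟨m, hm, hv⟩,
      w, (mem_altPlus R₁ R₂).2 ⟨k, hk, hw⟩, SgpFreeProduct.ext ?_, ?_⟩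
    · rw [SgpFreeProduct.seq_mul, seq_wordHom π₁ π₂ hl.chain hu, seq_wordHom π₁ π₂ hm.chain hv,
        seq_wordHom π₁ π₂ hk.chain hw, ← h, List.map_append]
    · rw [← hu, ← hv, ← hw, tableWord]

theorem isBlockSeq_append_inl_cons {l m : List (FreeSemigroup A₁ ⊕ FreeSemigroup A₂)}
    {u : FreeSemigroup A₁} : IsBlockSeq R₁ R₂ (l ++ .inl u :: m) ↔
      IsBlockSeq R₁ R₂ l ∧ lastSide l ≠ some true ∧ u ∈ R₁ ∧
        IsBlockSeq R₁ R₂ m ∧ headSide m ≠ some true := by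
  rw [isBlockSeq_append, isBlockSeq_inl_cons]
  simp only [headSide, List.head?_cons, Option.map_some, Sum.isLeft_inl]
  grind

theorem isBlockSeq_append_inr_cons {l m : List (FreeSemigroup A₁ ⊕ FreeSemigroup A₂)}
    {v : FreeSemigroup A₂} : IsBlockSeq R₁ R₂ (l ++ .inr v :: m) ↔
      IsBlockSeq R₁ R₂ l ∧ lastSide l ≠ some false ∧ v ∈ R₂ ∧
        IsBlockSeq R₁ R₂ m ∧ headSide m ≠ some false := by
  rw [isBlockSeq_append, isBlockSeq_inr_cons]
  simp only [headSide, List.head?_cons, Option.map_some, Sum.isLeft_inr]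
  grind

theorem IsBlockSeq.alternatise_map {l : List (FreeSemigroup A₁ ⊕ FreeSemigroup A₂)}
    (hl : IsBlockSeq R₁ R₂ l) :
    alternatise (l.map (Sum.map π₁ π₂)) = l.map (Sum.map π₁ π₂) :=
  alternatise_of_isChain ((isChain_map_sumMap π₁ π₂).2 hl.chain)

theorem alternatise_map_inl {l m : List (FreeSemigroup A₁ ⊕ FreeSemigroup A₂)}
    {u v w : FreeSemigroup A₁} (h : π₁ u * π₁ v = π₁ w)
    (hk : IsBlockSeq R₁ R₂ (l ++ .inl w :: m)) :
    alternatise ((l ++ [Sum.inl u] ++ Sum.inl v :: m).map (Sum.map π₁ π₂)) =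
      (l ++ Sum.inl w :: m).map (Sum.map π₁ π₂) := by
  have hc := (isChain_map_sumMap π₁ π₂).2 hk.chain
  simp only [List.map_append, List.map_cons, Sum.map_inl, ← h, List.append_assoc,
    List.singleton_append] at hc ⊢
  exact alternatise_inl_inl hc

theorem alternatise_map_inr {l m : List (FreeSemigroup A₁ ⊕ FreeSemigroup A₂)}
    {u v w : FreeSemigroup A₂} (h : π₂ u * π₂ v = π₂ w)
    (hk : IsBlockSeq R₁ R₂ (l ++ .inr w :: m)) :
    alternatise ((l ++ [Sum.inr u] ++ Sum.inr v :: m).map (Sum.map π₁ π₂)) =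
      (l ++ Sum.inr w :: m).map (Sum.map π₁ π₂) := by
  have hc := (isChain_map_sumMap π₁ π₂).2 hk.chain
  simp only [List.map_append, List.map_cons, Sum.map_inr, ← h, List.append_assoc,
    List.singleton_append] at hc ⊢
  exact alternatise_inr_inr hc

/-- The multiplication table of the free product is the union of the tables of products with the
two factors at the junction being different, both the first one, or both the second one. -/
theorem multTable_altPlus (h₁ : Set.BijOn π₁ R₁ Set.univ) (h₂ : Set.BijOn π₂ R₂ Set.univ) :
    multTable (SgpFreeProduct.wordHom π₁ π₂) (altPlus R₁ R₂) =
      concatTable (sidedLanguage R₁ R₂ (fun _ => True) (· = some true))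
        (sidedLanguage R₁ R₂ (· = some false) (fun _ => True)) +
      concatTable (sidedLanguage R₁ R₂ (fun _ => True) (· = some false))
        (sidedLanguage R₁ R₂ (· = some true) (fun _ => True)) +
      (sidedLanguage R₁ R₂ (fun _ => True) (· ≠ some true)).sandwich .inl
        ((multTable π₁ R₁).subst
          (tableSubst .inl (sidedLanguage R₁ R₂ (· ≠ some true) (fun _ => True)))) +
      (sidedLanguage R₁ R₂ (fun _ => True) (· ≠ some false)).sandwich .inl
        ((multTable π₂ R₂).subst
          (tableSubst .inr (sidedLanguage R₁ R₂ (· ≠ some false) (fun _ => True)))) := by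
  ext z
  rw [mem_multTable_altPlus]
  constructor
  · rintro ⟨l, m, k, hl, hm, hk, hl', hm', h, rfl⟩
    -- Expose the two blocks at the junction, the only ones that can interact.
    obtain ⟨l, x, rfl⟩ := (List.eq_nil_or_concat l).resolve_left hl'
    obtain ⟨y, m, rfl⟩ := List.exists_cons_of_ne_nil hm'
    rw [List.concat_eq_append] at *
    rcases x with u | u <;> rcases y with v | v
    · obtain ⟨hl, hlb, hu, -⟩ := isBlockSeq_append_inl_cons.1 hl
      obtain ⟨hv, hm, hmb⟩ := isBlockSeq_inl_cons.1 hm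
      -- Replacing the two junction blocks by `w` gives a block sequence with the same image as `k`,
      -- so uniqueness identifies it with `k`.
      obtain ⟨w, hw, hwuv⟩ := h₁.surjOn (Set.mem_univ (π₁ u * π₁ v))
      have hk' : IsBlockSeq R₁ R₂ (l ++ .inl w :: m) :=
        isBlockSeq_append_inl_cons.2 ⟨hl, hlb, hw, hm, hmb⟩
      rw [alternatise_map_inl hwuv.symm hk'] at h
      obtain rfl := hk'.eq_of_map_eq h₁.injOn h₂.injOn hk h
      refine .inl (.inr (mem_sandwich_subst_multTable.2 ⟨_, ⟨l, hl, trivial, hlb, rfl⟩, u, hu, v, hv,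
        w, hw, hwuv.symm, _, ⟨m, hm, hmb, trivial, rfl⟩, ?_⟩))
      simp [blockWord]
    -- With different factors at the junction the concatenation already alternates, and uniqueness
    -- makes it equal to `k`.
    · have hlm : IsBlockSeq R₁ R₂ ((l ++ [.inl u]) ++ .inr v :: m) :=
        isBlockSeq_append.2 ⟨hl, hm, by simp [lastSide, headSide]⟩
      rw [hlm.alternatise_map] at h
      obtain rfl := hlm.eq_of_map_eq h₁.injOn h₂.injOn hk h
      refine .inl (.inl (.inl (mem_concatTable.2 ⟨_, ⟨_, hl, trivial, by simp [lastSide], rfl⟩, _,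
        ⟨_, hm, rfl, trivial, rfl⟩, ?_⟩)))
      rw [blocksWord_append (l ++ _)]
    · have hlm : IsBlockSeq R₁ R₂ ((l ++ [.inr u]) ++ .inl v :: m) :=
        isBlockSeq_append.2 ⟨hl, hm, by simp [lastSide, headSide]⟩
      rw [hlm.alternatise_map] at h
      obtain rfl := hlm.eq_of_map_eq h₁.injOn h₂.injOn hk h
      refine .inl (.inl (.inr (mem_concatTable.2 ⟨_, ⟨_, hl, trivial, by simp [lastSide], rfl⟩, _,
        ⟨_, hm, rfl, trivial, rfl⟩, ?_⟩)))
      rw [blocksWord_append (l ++ _)]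
    · obtain ⟨hl, hlb, hu, -⟩ := isBlockSeq_append_inr_cons.1 hl
      obtain ⟨hv, hm, hmb⟩ := isBlockSeq_inr_cons.1 hm
      obtain ⟨w, hw, hwuv⟩ := h₂.surjOn (Set.mem_univ (π₂ u * π₂ v))
      have hk' : IsBlockSeq R₁ R₂ (l ++ .inr w :: m) :=
        isBlockSeq_append_inr_cons.2 ⟨hl, hlb, hw, hm, hmb⟩
      rw [alternatise_map_inr hwuv.symm hk'] at h
      obtain rfl := hk'.eq_of_map_eq h₁.injOn h₂.injOn hk h
      refine .inr (mem_sandwich_subst_multTable.2 ⟨_, ⟨l, hl, trivial, hlb, rfl⟩, u, hu, v, hv,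
        w, hw, hwuv.symm, _, ⟨m, hm, hmb, trivial, rfl⟩, ?_⟩)
      simp [blockWord]
  · rintro (((h | h) | h) | h)
    · obtain ⟨_, ⟨l, hl, -, hlb, rfl⟩, _, ⟨m, hm, hmb, -, rfl⟩, rfl⟩ := mem_concatTable.1 h
      have hlm : IsBlockSeq R₁ R₂ (l ++ m) := isBlockSeq_append.2 ⟨hl, hm, by simp [hlb, hmb]⟩
      refine ⟨l, m, l ++ m, hl, hm, hlm, ?_, ?_, hlm.alternatise_map, by simp⟩
      · rintro rfl
        cases hlb
      · rintro rfl
        cases hmb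
    · obtain ⟨_, ⟨l, hl, -, hlb, rfl⟩, _, ⟨m, hm, hmb, -, rfl⟩, rfl⟩ := mem_concatTable.1 h
      have hlm : IsBlockSeq R₁ R₂ (l ++ m) := isBlockSeq_append.2 ⟨hl, hm, by simp [hlb, hmb]⟩
      refine ⟨l, m, l ++ m, hl, hm, hlm, ?_, ?_, hlm.alternatise_map, by simp⟩
      · rintro rfl
        cases hlb
      · rintro rfl
        cases hmb
    · obtain ⟨_, ⟨l, hl, -, hlb, rfl⟩, u, hu, v, hv, w, hw, huvw, _, ⟨m, hm, hmb, -, rfl⟩, rfl⟩ :=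
        mem_sandwich_subst_multTable.1 h
      have hk : IsBlockSeq R₁ R₂ (l ++ .inl w :: m) :=
        isBlockSeq_append_inl_cons.2 ⟨hl, hlb, hw, hm, hmb⟩
      exact ⟨l ++ [.inl u], .inl v :: m, l ++ .inl w :: m,
        isBlockSeq_append_inl_cons.2 ⟨hl, hlb, hu, isBlockSeq_nil _ _, by simp [headSide]⟩,
        isBlockSeq_inl_cons.2 ⟨hv, hm, hmb⟩, hk, by simp, by simp,
        alternatise_map_inl huvw hk, by simp [blockWord]⟩
    · obtain ⟨_, ⟨l, hl, -, hlb, rfl⟩, u, hu, v, hv, w, hw, huvw, _, ⟨m, hm, hmb, -, rfl⟩, rfl⟩ :=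
        mem_sandwich_subst_multTable.1 h
      have hk : IsBlockSeq R₁ R₂ (l ++ .inr w :: m) :=
        isBlockSeq_append_inr_cons.2 ⟨hl, hlb, hw, hm, hmb⟩
      exact ⟨l ++ [.inr u], .inr v :: m, l ++ .inr w :: m,
        isBlockSeq_append_inr_cons.2 ⟨hl, hlb, hu, isBlockSeq_nil _ _, by simp [headSide]⟩,
        isBlockSeq_inr_cons.2 ⟨hv, hm, hmb⟩, hk, by simp, by simp,
        alternatise_map_inr huvw hk, by simp [blockWord]⟩

theorem IsWordHyperbolicWithUniquenessWrt.freeProduct [Finite A₁] [Finite A₂]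
    (h₁ : IsWordHyperbolicWithUniquenessWrt π₁ R₁)
    (h₂ : IsWordHyperbolicWithUniquenessWrt π₂ R₂) :
    IsWordHyperbolicWithUniquenessWrt (SgpFreeProduct.wordHom π₁ π₂) (altPlus R₁ R₂) := by
  have hbij := bijOn_altPlus h₁.bijOn h₂.bijOn
  have hreg := isRegular_sidedLanguage h₁.combing.regular h₂.combing.regular
  -- Substitution into the table of a factor needs that table's alphabet, separators included, to be
  -- finite.
  have : Finite Separator := Finite.of_surjective (fun b : Bool => bif b then .one else .two) (by
    rintro (_ | _)
    exacts [⟨true, rfl⟩, ⟨false, rfl⟩])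
  refine ⟨⟨fun s => ?_, isRegular_altPlus h₁.combing.regular h₂.combing.regular, hbij.surjOn⟩,
    hbij, ?_⟩
  · obtain ⟨w, -, hw⟩ := hbij.surjOn (Set.mem_univ s)
    exact ⟨w, hw⟩
  · rw [multTable_altPlus h₁.bijOn h₂.bijOn]
    refine (((isContextFree_concatTable (hreg _ _) (hreg _ _)).add
      (isContextFree_concatTable (hreg _ _) (hreg _ _))).add (.sandwich (hreg _ _) _ ?_)).add
      (.sandwich (hreg _ _) _ ?_)
    · exact h₁.contextFree.subst (isContextFree_tableSubst _ (hreg _ _))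
    · exact h₂.contextFree.subst (isContextFree_tableSubst _ (hreg _ _))

end Table

theorem mainTheorem12 {S₁ S₂ : Type*} [Semigroup S₁] [Semigroup S₂] :
    (∀ {A₁ A₂ : Type*} [Finite A₁] [Finite A₂]
      (π₁ : FreeSemigroup A₁ →ₙ* S₁) (π₂ : FreeSemigroup A₂ →ₙ* S₂)
      (R₁ : Set (FreeSemigroup A₁)) (R₂ : Set (FreeSemigroup A₂)),
      IsWordHyperbolicWithUniquenessWrt π₁ R₁ →
      IsWordHyperbolicWithUniquenessWrt π₂ R₂ →
      IsWordHyperbolicWithUniquenessWrt (SgpFreeProduct.wordHom π₁ π₂) (altPlus R₁ R₂)) ∧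
    (IsWordHyperbolicWithUniqueness S₁ → IsWordHyperbolicWithUniqueness S₂ →
      IsWordHyperbolicWithUniqueness (SgpFreeProduct S₁ S₂)) := by
  refine ⟨fun _ _ _ _ h₁ h₂ => h₁.freeProduct h₂, ?_⟩
  rintro ⟨A₁, _, π₁, R₁, h₁⟩ ⟨A₂, _, π₂, R₂, h₂⟩
  exact ⟨A₁ ⊕ A₂, inferInstance, _, _, h₁.freeProduct h₂⟩
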